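/- Let $d\ge 1$ be an integer and let $1<r<p<\infty$. For $0<\alpha<d$ put $$R_\alpha f(x)=\int_{\mathbb R^d}\frac{f(y)}{|x-y|^{d-\alpha}}\,dy ,\qquad \|b\|_{\dot E_{p,\alpha}}=\sup_{\rho>0}\rho^{\alpha}\sup_{B}\Big(\frac1{|B|}\int_B |b|^p\,dx\Big)^{1/p},$$ where the inner supremum is over all open balls $B\subset\mathbb R^d$ of radius $\rho$. (a) For every $\alpha\in(0,d)$ there is a finite constant $N$ depending only on $\alpha,d,r,p$ such that, whenever $b\ge0$ is a measurable function on $\mathbb R^d$, $f\in L_r(\mathbb R^d)$, and $\|b\|_{\dot E_{p,\alpha}}\le A\in[0,\infty]$, $$\int_{\mathbb R^d} b^r|R_\alpha f|^r\,dx\le N A^r\int_{\mathbb R^d}|f|^r\,dx .$$ (Here, if $A<\infty$, the integral defining $R_\alpha f(x)$ converges absolutely for almost every $x$ with $b(x)\neq0$; if $A=\infty$, the right-hand side is $\infty$ unless $f=0$ a.e., in which case both sides are $0$.) (b) If $d\ge2$, there is a finite constant $N$ depending only on $d,r,p$ such that, whenever $b\ge0$ is a measurable function with $\|b\|_{\dot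 E_{p,1}}\le A\in[0,\infty]$ and $u\in C_0^\infty(\mathbb R^d)$, $$\int_{\mathbb R^d} b^r|u|^r\,dx\le N A^r\int_{\mathbb R^d}|Du|^r\,dx,\qquad \int_{\mathbb R^d} b^r|Du|^r\,dx\le N A^r\int_{\mathbb R^d}|D^2u|^r\,dx ,$$ where $|Du|^2=\sum_i|D_iu|^2$, $|D^2u|^2=\sum_{i,j}|D_iD_ju|^2$, and $\infty\cdot0=0$. -/

import Mathlib

open MeasureTheory
open scoped ENNReal NNReal ContDiff

/-- The Riesz potential `R_α f (x) = ∫ f(y) / |x - y|^(d - α) dy` on `ℝ^d`. -/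
noncomputable def rieszPotential (d : ℕ) (α : ℝ) (f : EuclideanSpace ℝ (Fin d) → ℝ)
    (x : EuclideanSpace ℝ (Fin d)) : ℝ :=
  ∫ y, f y / ‖x - y‖ ^ ((d : ℝ) - α)

/-- The homogeneous Morrey norm
`‖b‖ = sup_{ρ > 0} ρ^α sup_{B a ball of radius ρ} (⨍_B |b|^p dx)^(1/p)`, with values in `[0, ∞]`. -/
noncomputable def morreyNorm (d : ℕ) (p α : ℝ) (b : EuclideanSpace ℝ (Fin d) → ℝ) : ℝ≥0∞ :=
  ⨆ (ρ : ℝ) (_ : 0 < ρ), ENNReal.ofReal (ρ ^ α) *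
    ⨆ x : EuclideanSpace ℝ (Fin d), (⨍⁻ y in Metric.ball x ρ, ‖b y‖ₑ ^ p ∂volume) ^ (1 / p)

/-- The Euclidean length `|Du(x)| = (∑_i |D_i u(x)|²)^(1/2)` of the gradient. -/
noncomputable def gradNorm (d : ℕ) (u : EuclideanSpace ℝ (Fin d) → ℝ)
    (x : EuclideanSpace ℝ (Fin d)) : ℝ :=
  Real.sqrt (∑ i : Fin d, (fderiv ℝ u x (EuclideanSpace.single i 1)) ^ 2)

/-- The Euclidean length `|D²u(x)| = (∑_{i,j} |D_i D_j u(x)|²)^(1/2)` of the Hessian. -/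
noncomputable def hessNorm (d : ℕ) (u : EuclideanSpace ℝ (Fin d) → ℝ)
    (x : EuclideanSpace ℝ (Fin d)) : ℝ :=
  Real.sqrt (∑ i : Fin d, ∑ j : Fin d,
    (fderiv ℝ (fun y => fderiv ℝ u y (EuclideanSpace.single j 1)) x
      (EuclideanSpace.single i 1)) ^ 2)

set_option linter.unusedSectionVars false

section MaximalFunction

variable {E : Type*} [NormedAddCommGroup E] [MeasurableSpace E]

/-- The centered Hardy–Littlewood maximal function, over balls of rational radius. -/
noncomputable def maximalFunction (μ : Measure E) (f : E → ℝ≥0∞) (x : E) : ℝ≥0∞ :=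
  ⨆ (q : ℚ) (_ : 0 < q), (μ (Metric.closedBall x q))⁻¹ *
    ∫⁻ y in Metric.closedBall x q, f y ∂μ

variable [NormedSpace ℝ E] [FiniteDimensional ℝ E] [BorelSpace E]
  (μ : Measure E) [μ.IsAddHaarMeasure]

theorem measurable_setLIntegral_closedBall {f : E → ℝ≥0∞} (hf : Measurable f) (q : ℝ) :
    Measurable fun x => ∫⁻ y in Metric.closedBall x q, f y ∂μ := by
  have h : ∀ x, ∫⁻ y in Metric.closedBall x q, f y ∂μ =
      ∫⁻ y, {z : E × E | dist z.2 z.1 ≤ q}.indicator (fun z => f z.2) (x, y) ∂μ := by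
    intro x
    rw [← lintegral_indicator Metric.isClosed_closedBall.measurableSet]
    rfl
  simp_rw [h]
  refine Measurable.lintegral_prod_right' (f := fun z : E × E =>
    {z : E × E | dist z.2 z.1 ≤ q}.indicator (fun z => f z.2) z) ?_
  exact (hf.comp measurable_snd).indicator
    (isClosed_le (continuous_snd.dist continuous_fst) continuous_const).measurableSet

theorem measurable_maximalFunction {f : E → ℝ≥0∞} (hf : Measurable f) :
    Measurable (maximalFunction μ f) := by
  refine Measurable.iSup fun q => Measurable.iSup fun _ => ?_
  refine Measurable.mul ?_ (measurable_setLIntegral_closedBall μ hf q)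
  have : ∀ x : E, μ (Metric.closedBall x q) = μ (Metric.closedBall 0 q) :=
    fun x => Measure.addHaar_closedBall_center μ x q
  simp_rw [this]
  exact measurable_const

theorem measure_closedBall_mul (x y : E) {c ρ : ℝ} (hc : 0 ≤ c) (hρ : 0 ≤ ρ) :
    μ (Metric.closedBall x (c * ρ)) =
      ENNReal.ofReal c ^ Module.finrank ℝ E * μ (Metric.closedBall y ρ) := by
  rw [Measure.addHaar_closedBall_mul μ x hc hρ, ENNReal.ofReal_pow hc,
    Measure.addHaar_closedBall_center μ y]

theorem setLIntegral_closedBall_le_maximalFunction (f : E → ℝ≥0∞) (x : E) {ρ : ℝ} (hρ : 0 < ρ) :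
    ∫⁻ y in Metric.closedBall x ρ, f y ∂μ ≤
      2 ^ Module.finrank ℝ E * μ (Metric.closedBall x ρ) * maximalFunction μ f x := by
  obtain ⟨q, hq, hq'⟩ := exists_rat_btwn (show ρ < 2 * ρ by linarith)
  have hq0 : (0 : ℝ) < q := hρ.trans hq
  have hle : (μ (Metric.closedBall x (q : ℝ)))⁻¹ * ∫⁻ y in Metric.closedBall x q, f y ∂μ ≤
      maximalFunction μ f x :=
    le_iSup₂_of_le q (by exact_mod_cast hq0) le_rfl
  have h0 : μ (Metric.closedBall x (q : ℝ)) ≠ 0 := (Metric.measure_closedBall_pos μ x hq0).ne'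
  have ht : μ (Metric.closedBall x (q : ℝ)) ≠ ⊤ := measure_closedBall_lt_top.ne
  calc ∫⁻ y in Metric.closedBall x ρ, f y ∂μ
      ≤ ∫⁻ y in Metric.closedBall x q, f y ∂μ :=
        lintegral_mono_set (Metric.closedBall_subset_closedBall hq.le)
    _ = μ (Metric.closedBall x (q : ℝ)) * ((μ (Metric.closedBall x (q : ℝ)))⁻¹ *
          ∫⁻ y in Metric.closedBall x q, f y ∂μ) := by
        rw [← mul_assoc, ENNReal.mul_inv_cancel h0 ht, one_mul]
    _ ≤ μ (Metric.closedBall x (2 * ρ)) * maximalFunction μ f x := by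
        gcongr
    _ = _ := by
        rw [measure_closedBall_mul μ x x (by norm_num) hρ.le]
        norm_num

/-- Local weak type `(1, 1)` bound for the maximal function above the level of the averages over
large balls. -/
theorem mul_measure_maximalFunction_le {f : E → ℝ≥0∞} (x : E) {ρ : ℝ}
    {Λ l : ℝ≥0∞} (hl : Λ ≤ l)
    (hΛ : ∀ y ∈ Metric.closedBall x ρ, ∀ q, ρ ≤ q →
      ∫⁻ z in Metric.closedBall y q, f z ∂μ ≤ Λ * μ (Metric.closedBall y q)) :
    l * μ {y ∈ Metric.closedBall x ρ | l < maximalFunction μ f y} ≤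
      5 ^ Module.finrank ℝ E * ∫⁻ z in Metric.closedBall x (2 * ρ), f z ∂μ := by
  set t := {y ∈ Metric.closedBall x ρ | l < maximalFunction μ f y} with ht
  have hex : ∀ y ∈ t, ∃ q : ℝ, 0 < q ∧ q < ρ ∧
      l * μ (Metric.closedBall y q) ≤ ∫⁻ z in Metric.closedBall y q, f z ∂μ := by
    rintro y ⟨hy, hly⟩
    obtain ⟨q, hq⟩ := lt_iSup_iff.1 hly
    obtain ⟨hq0, hq⟩ := lt_iSup_iff.1 hq
    have hq0' : (0 : ℝ) < q := by exact_mod_cast hq0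
    have h0 : μ (Metric.closedBall y (q : ℝ)) ≠ 0 := (Metric.measure_closedBall_pos μ y hq0').ne'
    have htop : μ (Metric.closedBall y (q : ℝ)) ≠ ⊤ := measure_closedBall_lt_top.ne
    have hq2 : l * μ (Metric.closedBall y (q : ℝ)) < ∫⁻ z in Metric.closedBall y q, f z ∂μ := by
      rw [mul_comm, ← div_eq_mul_inv] at hq
      exact (ENNReal.lt_div_iff_mul_lt (Or.inl h0) (Or.inl htop)).1 hq
    refine ⟨q, hq0', ?_, hq2.le⟩
    by_contra! hρq
    exact absurd (hΛ y hy q hρq) (not_le.2 (lt_of_le_of_lt (by gcongr) hq2))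
  choose! q hq0 hqρ hq using hex
  obtain ⟨u, hut, hdisj, hcov⟩ := Vitali.exists_disjoint_subfamily_covering_enlargement_closedBall
    t id q ρ (fun a ha => (hqρ a ha).le) 5 (by norm_num)
  have hcount : u.Countable := by
    refine hdisj.countable_of_nonempty_interior fun a ha => ?_
    exact ⟨a, mem_interior_iff_mem_nhds.2 (Metric.closedBall_mem_nhds a (hq0 a (hut ha)))⟩
  have hsub : t ⊆ ⋃ b ∈ u, Metric.closedBall b (5 * q b) := by
    intro a ha
    obtain ⟨b, hb, hab⟩ := hcov a ha
    exact Set.mem_biUnion hb (hab (Metric.mem_closedBall_self (hq0 a ha).le))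
  calc l * μ t ≤ l * ∑' b : u, μ (Metric.closedBall (b : E) (5 * q b)) := by
        gcongr
        exact (measure_mono hsub).trans (measure_biUnion_le μ hcount _)
    _ = ∑' b : u, 5 ^ Module.finrank ℝ E * (l * μ (Metric.closedBall (b : E) (q b))) := by
        rw [← ENNReal.tsum_mul_left]
        congr 1 with b
        rw [measure_closedBall_mul μ (b : E) b (by norm_num) (hq0 b (hut b.2)).le]
        norm_num
        ring
    _ ≤ ∑' b : u, 5 ^ Module.finrank ℝ E * ∫⁻ z in Metric.closedBall (b : E) (q b), f z ∂μ := by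
        gcongr with b
        exact hq b (hut b.2)
    _ = 5 ^ Module.finrank ℝ E * ∫⁻ z in ⋃ b ∈ u, Metric.closedBall b (q b), f z ∂μ := by
        rw [ENNReal.tsum_mul_left]
        exact congrArg _ (lintegral_biUnion hcount
          (fun b _ => Metric.isClosed_closedBall.measurableSet) hdisj f).symm
    _ ≤ _ := by
        gcongr
        refine Set.iUnion₂_subset fun b hb => Metric.closedBall_subset_closedBall' ?_
        have h1 := hqρ b (hut hb)
        have h2 : dist b x ≤ ρ := (hut hb).1
        linarith

theorem rpow_le_add_tsum_dyadic {δ : ℝ} (hδ : 0 < δ) (W : ℝ≥0∞) {Λ : ℝ≥0∞} (hΛ0 : Λ ≠ 0)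
    (hΛ : Λ ≠ ⊤) :
    W ^ δ ≤ Λ ^ δ + ∑' j : ℕ, (2 ^ (j + 1) * Λ) ^ δ * (Set.Ioi (2 ^ j * Λ)).indicator 1 W := by
  rcases eq_or_ne W ⊤ with rfl | hW
  · have h : ∑' j : ℕ, (2 ^ (j + 1) * Λ) ^ δ *
        (Set.Ioi (2 ^ j * Λ)).indicator (1 : ℝ≥0∞ → ℝ≥0∞) ⊤ = ⊤ := by
      refine top_unique ?_
      have hc : Λ ^ δ ≠ 0 := by
        simp [ENNReal.rpow_eq_zero_iff, hΛ0, hΛ]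
      refine (ENNReal.tsum_const_eq_top_of_ne_zero (α := ℕ) hc).symm.le.trans ?_
      gcongr with j
      have : (⊤ : ℝ≥0∞) ∈ Set.Ioi (2 ^ j * Λ) :=
        ENNReal.mul_lt_top (ENNReal.pow_lt_top (by simp)) hΛ.lt_top
      rw [Set.indicator_of_mem this, Pi.one_apply, mul_one]
      gcongr
      exact le_mul_of_one_le_left zero_le (one_le_pow₀ (by norm_num))
    rw [h]
    simp
  · rcases le_or_gt W Λ with h | h
    · exact le_add_right (by gcongr)
    have hex : ∃ n : ℕ, W ≤ 2 ^ n * Λ := by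
      obtain ⟨n, hn⟩ := ENNReal.exists_nat_mul_gt hΛ0 hW
      refine ⟨n, hn.le.trans ?_⟩
      gcongr
      exact_mod_cast Nat.lt_two_pow_self.le
    classical
    obtain ⟨j, hj⟩ : ∃ j, Nat.find hex = j + 1 := by
      refine Nat.exists_eq_succ_of_ne_zero fun h0 => ?_
      have := Nat.find_spec hex
      rw [h0, pow_zero, one_mul] at this
      exact absurd this (not_le.2 h)
    have h1 : W ≤ 2 ^ (j + 1) * Λ := by
      have := Nat.find_spec hex
      rwa [hj] at this
    have h2 : 2 ^ j * Λ < W := not_le.1 (Nat.find_min hex (by omega))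
    refine le_add_left ((ENNReal.le_tsum j).trans' ?_)
    rw [Set.indicator_of_mem (show W ∈ Set.Ioi (2 ^ j * Λ) from h2), Pi.one_apply, mul_one]
    gcongr

/-- Kolmogorov's inequality for the maximal function. -/
theorem exists_setLIntegral_maximalFunction_rpow_le {δ : ℝ} (hδ : 0 < δ) (hδ1 : δ < 1) :
    ∃ C : ℝ≥0, ∀ (f : E → ℝ≥0∞), Measurable f → ∀ (x : E) (ρ : ℝ), 0 < ρ → ∀ Λ : ℝ≥0∞,
      Λ ≠ 0 → Λ ≠ ⊤ →
      (∀ y ∈ Metric.closedBall x ρ, ∀ q, ρ ≤ q →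
        ∫⁻ z in Metric.closedBall y q, f z ∂μ ≤ Λ * μ (Metric.closedBall y q)) →
      ∫⁻ y in Metric.closedBall x ρ, maximalFunction μ f y ^ δ ∂μ ≤
        C * μ (Metric.closedBall x ρ) * Λ ^ δ := by
  set S : ℝ≥0∞ := 1 + 2 ^ δ * 10 ^ Module.finrank ℝ E * ∑' j : ℕ, ((2 : ℝ≥0∞) ^ (δ - 1)) ^ j with hS
  have hS_top : S ≠ ⊤ := by
    have h1 : (2 : ℝ≥0∞) ^ (δ - 1) < 1 :=
      ENNReal.rpow_lt_one_of_one_lt_of_neg (by norm_num) (by linarith)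
    rw [hS, ENNReal.tsum_geometric]
    refine ENNReal.add_ne_top.2 ⟨by simp, ENNReal.mul_ne_top (ENNReal.mul_ne_top
      (ENNReal.rpow_ne_top_of_nonneg hδ.le (by simp)) (by simp)) ?_⟩
    rw [ENNReal.inv_ne_top]
    exact (tsub_pos_of_lt h1).ne'
  refine ⟨S.toNNReal, fun f hf x ρ hρ Λ hΛ0 hΛ h => ?_⟩
  rw [ENNReal.coe_toNNReal hS_top]
  set B := Metric.closedBall x ρ
  have hW := measurable_maximalFunction μ hf
  have hlevel : ∀ j : ℕ, μ {y ∈ B | 2 ^ j * Λ < maximalFunction μ f y} ≤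
      10 ^ Module.finrank ℝ E * μ B * ((2 : ℝ≥0∞) ^ j)⁻¹ := by
    intro j
    have h1 := mul_measure_maximalFunction_le μ x (Λ := Λ) (l := 2 ^ j * Λ)
      (le_mul_of_one_le_left zero_le (one_le_pow₀ (by norm_num))) h
    have h2 := h x (Metric.mem_closedBall_self hρ.le) (2 * ρ) (by linarith)
    rw [measure_closedBall_mul μ x x (by norm_num) hρ.le] at h2
    have h3 : Λ * (2 ^ j * μ {y ∈ B | 2 ^ j * Λ < maximalFunction μ f y}) ≤
        Λ * (10 ^ Module.finrank ℝ E * μ B) := by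
      calc _ = 2 ^ j * Λ * μ {y ∈ B | 2 ^ j * Λ < maximalFunction μ f y} := by ring
        _ ≤ _ := h1
        _ ≤ 5 ^ Module.finrank ℝ E *
            (Λ * (ENNReal.ofReal 2 ^ Module.finrank ℝ E * μ B)) := by gcongr
        _ = _ := by
          rw [show (10 : ℝ≥0∞) = 5 * 2 by norm_num, mul_pow]
          norm_num
          ring
    rw [ENNReal.mul_le_mul_iff_right hΛ0 hΛ] at h3
    rw [← div_eq_mul_inv, ENNReal.le_div_iff_mul_le (by simp) (by simp), mul_comm]
    exact h3
  have hmeas : ∀ j : ℕ, Measurable fun y =>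
      (Set.Ioi (2 ^ j * Λ)).indicator (1 : ℝ≥0∞ → ℝ≥0∞) (maximalFunction μ f y) := fun j =>
    (measurable_one.indicator measurableSet_Ioi).comp hW
  calc ∫⁻ y in B, maximalFunction μ f y ^ δ ∂μ
      ≤ ∫⁻ y in B, (Λ ^ δ + ∑' j : ℕ, (2 ^ (j + 1) * Λ) ^ δ *
          (Set.Ioi (2 ^ j * Λ)).indicator 1 (maximalFunction μ f y)) ∂μ := by
        gcongr with y
        exact rpow_le_add_tsum_dyadic hδ _ hΛ0 hΛ
    _ = Λ ^ δ * μ B + ∑' j : ℕ, (2 ^ (j + 1) * Λ) ^ δ *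
          μ {y ∈ B | 2 ^ j * Λ < maximalFunction μ f y} := by
        rw [lintegral_add_left measurable_const, setLIntegral_const,
          lintegral_tsum fun j => ((hmeas j).const_mul _).aemeasurable]
        congr 2 with j
        rw [lintegral_const_mul _ (hmeas j)]
        congr 1
        have : (fun y => (Set.Ioi (2 ^ j * Λ)).indicator (1 : ℝ≥0∞ → ℝ≥0∞)
            (maximalFunction μ f y)) =
            {y | 2 ^ j * Λ < maximalFunction μ f y}.indicator 1 := rfl
        rw [this, lintegral_indicator_one (measurableSet_lt measurable_const hW),
          Measure.restrict_apply (measurableSet_lt measurable_const hW), Set.inter_comm]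
        rfl
    _ ≤ Λ ^ δ * μ B + ∑' j : ℕ, (2 ^ (j + 1) * Λ) ^ δ *
          (10 ^ Module.finrank ℝ E * μ B * ((2 : ℝ≥0∞) ^ j)⁻¹) := by
        gcongr with j
        exact hlevel j
    _ = S * μ B * Λ ^ δ := by
        have : ∀ j : ℕ, (2 ^ (j + 1) * Λ) ^ δ *
            (10 ^ Module.finrank ℝ E * μ B * ((2 : ℝ≥0∞) ^ j)⁻¹) =
            (2 ^ δ * 10 ^ Module.finrank ℝ E * μ B * Λ ^ δ) * ((2 : ℝ≥0∞) ^ (δ - 1)) ^ j := by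
          intro j
          have e : ((2 : ℝ≥0∞) ^ (δ - 1)) ^ j = ((2 : ℝ≥0∞) ^ δ) ^ j * (2 ^ j)⁻¹ := by
            rw [ENNReal.rpow_sub _ _ (by simp) (by simp), ENNReal.rpow_one, div_eq_mul_inv,
              mul_pow, ENNReal.inv_pow]
          rw [e, ENNReal.mul_rpow_of_nonneg _ _ hδ.le, pow_succ,
            ENNReal.mul_rpow_of_nonneg _ _ hδ.le, ← ENNReal.rpow_natCast, ← ENNReal.rpow_mul,
            mul_comm (j : ℝ), ENNReal.rpow_mul, ENNReal.rpow_natCast, ENNReal.rpow_natCast]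
          ring
        simp_rw [this]
        rw [ENNReal.tsum_mul_left, hS]
        ring

end MaximalFunction

section Potential

open Filter Topology

variable {E : Type*} [NormedAddCommGroup E] [MeasurableSpace E] [NormedSpace ℝ E]

/-- The Riesz potential of a nonnegative function, with values in `[0, ∞]`. -/
noncomputable def lRieszPotential (μ : Measure E) (α : ℝ) (f : E → ℝ≥0∞) (x : E) : ℝ≥0∞ :=
  ∫⁻ y, f y * ‖x - y‖ₑ ^ (α - Module.finrank ℝ E) ∂μ

variable [FiniteDimensional ℝ E] [BorelSpace E] (μ : Measure E) [μ.IsAddHaarMeasure]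

theorem ae_le_maximalFunction {f : E → ℝ≥0∞} (hf : Measurable f)
    (hfin : ∀ ρ : ℝ, ∫⁻ y in Metric.closedBall 0 ρ, f y ∂μ ≠ ⊤) :
    ∀ᵐ x ∂μ, f x ≤ maximalFunction μ f x := by
  have h : ∀ n : ℕ, ∀ᵐ x ∂μ, (Metric.closedBall (0 : E) n).indicator f x ≤
      maximalFunction μ f x := by
    intro n
    have hB : MeasurableSet (Metric.closedBall (0 : E) n) :=
      Metric.isClosed_closedBall.measurableSet
    filter_upwards [VitaliFamily.ae_tendsto_lintegral_div (Besicovitch.vitaliFamily μ)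
      (f := (Metric.closedBall (0 : E) n).indicator f) (hf.indicator hB).aemeasurable
      (by rw [lintegral_indicator hB]; exact hfin n)] with x hx
    have hseq : Tendsto (fun k : ℕ => (((1 / (k + 1) : ℚ)) : ℝ)) atTop (𝓝[>] 0) := by
      refine tendsto_nhdsWithin_iff.2 ⟨?_, Eventually.of_forall fun k => ?_⟩
      · push_cast
        exact tendsto_one_div_add_atTop_nhds_zero_nat
      · have : (0 : ℝ) < ((1 / (k + 1) : ℚ) : ℝ) := by push_cast; positivity
        exact this
    refine le_of_tendsto' (hx.comp ((Besicovitch.tendsto_filterAt μ x).comp hseq)) fun k => ?_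
    refine le_iSup₂_of_le (1 / (k + 1) : ℚ) (by positivity) ?_
    simp only [Function.comp]
    rw [div_eq_mul_inv, mul_comm]
    gcongr
    exact Set.indicator_le_self _ _ _
  filter_upwards [ae_all_iff.2 h] with x hx
  obtain ⟨n, hn⟩ := exists_nat_ge ‖x‖
  have := hx n
  rwa [Set.indicator_of_mem (by simpa using hn)] at this

theorem measurable_lRieszPotential (α : ℝ) {f : E → ℝ≥0∞} (hf : Measurable f) :
    Measurable (lRieszPotential μ α f) := by
  refine Measurable.lintegral_prod_right'
    (f := fun z : E × E => f z.2 * ‖z.1 - z.2‖ₑ ^ (α - Module.finrank ℝ E)) ?_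
  exact (hf.comp measurable_snd).mul
    ((measurable_fst.sub measurable_snd).enorm.pow_const _)

theorem summable_dyadic_min {α β : ℝ} (hα : 0 < α) (hαβ : α < β) :
    Summable fun n : ℤ => (2 : ℝ) ^ (n * α) * min 1 ((2 : ℝ) ^ (-((n + 1) * β))) := by
  have hpos : ∀ n : ℤ, 0 ≤ (2 : ℝ) ^ (n * α) * min 1 ((2 : ℝ) ^ (-((n + 1) * β))) := fun n => by
    positivity
  refine Summable.of_nat_of_neg ?_ ?_
  · refine Summable.of_nonneg_of_le (fun k => hpos k) (fun k => ?_)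
      (summable_geometric_of_lt_one (r := (2 : ℝ) ^ (α - β)) (by positivity)
        (Real.rpow_lt_one_of_one_lt_of_neg (by norm_num) (by linarith)))
    calc (2 : ℝ) ^ (((k : ℤ) : ℝ) * α) * min 1 ((2 : ℝ) ^ (-((((k : ℤ) : ℝ) + 1) * β)))
        ≤ (2 : ℝ) ^ ((k : ℝ) * α) * (2 : ℝ) ^ (-((k : ℝ) * β)) := by
          push_cast
          gcongr
          refine (min_le_right _ _).trans (Real.rpow_le_rpow_of_exponent_le (by norm_num) ?_)
          nlinarith
      _ = ((2 : ℝ) ^ (α - β)) ^ k := by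
          rw [← Real.rpow_add (by norm_num), ← Real.rpow_natCast, ← Real.rpow_mul (by norm_num)]
          ring_nf
  · refine Summable.of_nonneg_of_le (fun k => hpos _) (fun k => ?_)
      (summable_geometric_of_lt_one (r := (2 : ℝ) ^ (-α)) (by positivity)
        (Real.rpow_lt_one_of_one_lt_of_neg (by norm_num) (by linarith)))
    calc (2 : ℝ) ^ (((-(k : ℤ) : ℤ) : ℝ) * α) *
          min 1 ((2 : ℝ) ^ (-((((-(k : ℤ) : ℤ) : ℝ) + 1) * β)))
        ≤ (2 : ℝ) ^ (-(k : ℝ) * α) * 1 := by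
          push_cast
          gcongr
          exact min_le_left _ _
      _ = ((2 : ℝ) ^ (-α)) ^ k := by
          rw [mul_one, ← Real.rpow_natCast, ← Real.rpow_mul (by norm_num)]
          ring_nf

/-- A function whose ball averages around `x` are at most `T min(1, (R/ρ)^β)` with `β > α` has
Riesz potential at most a multiple of `R^α T` at `x`. -/
theorem exists_lRieszPotential_le {α β : ℝ} (hα : 0 < α) (hαd : α < Module.finrank ℝ E)
    (hαβ : α < β) :
    ∃ C : ℝ≥0, ∀ g : E → ℝ≥0∞, Measurable g → ∀ (x : E) (R : ℝ) (T : ℝ≥0∞), 0 < R →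
      (∀ ρ : ℝ, 0 < ρ → ∫⁻ y in Metric.closedBall x ρ, g y ∂μ ≤
        ENNReal.ofReal (ρ ^ (Module.finrank ℝ E : ℝ)) * T) →
      (∀ ρ : ℝ, 0 < ρ → ∫⁻ y in Metric.closedBall x ρ, g y ∂μ ≤
        ENNReal.ofReal (ρ ^ (Module.finrank ℝ E : ℝ) * (R / ρ) ^ β) * T) →
      lRieszPotential μ α g x ≤ C * ENNReal.ofReal (R ^ α) * T := by
  set D : ℝ := (Module.finrank ℝ E : ℝ) with hD
  have : Nontrivial E := Module.nontrivial_of_finrank_pos (R := ℝ) (Nat.cast_pos.1 (hα.trans hαd))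
  set c : ℤ → ℝ := fun n => (2 : ℝ) ^ (n * α) * min 1 ((2 : ℝ) ^ (-((n + 1) * β))) with hc
  have hc0 : ∀ n, 0 ≤ c n := fun n => by positivity
  have hS : ∑' n, ENNReal.ofReal (2 ^ D * c n) ≠ ⊤ :=
    ((summable_dyadic_min hα hαβ).mul_left _).tsum_ofReal_ne_top
  refine ⟨(∑' n, ENNReal.ofReal (2 ^ D * c n)).toNNReal, fun g hg x R T hR h1 h2 => ?_⟩
  rw [ENNReal.coe_toNNReal hS]
  set ρ : ℤ → ℝ := fun n => R * 2 ^ (n : ℝ) with hρ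
  have hρ0 : ∀ n, 0 < ρ n := fun n => by positivity
  have hρs : ∀ n : ℤ, ρ (n + 1) = 2 * ρ n := fun n => by
    simp only [hρ]
    push_cast
    rw [Real.rpow_add (by norm_num), Real.rpow_one]
    ring
  have hB : ∀ n, MeasurableSet (Metric.closedBall x (ρ n)) := fun n =>
    Metric.isClosed_closedBall.measurableSet
  have hpt : ∀ᵐ y ∂μ, g y * ‖x - y‖ₑ ^ (α - D) ≤
      ∑' n : ℤ, ENNReal.ofReal (ρ n ^ (α - D)) *
        (Metric.closedBall x (ρ (n + 1))).indicator g y := by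
    have hne : ∀ᵐ y ∂μ, y ≠ x := by simp [ae_iff, measure_singleton]
    filter_upwards [hne] with y hy
    have hxy : 0 < ‖x - y‖ := norm_pos_iff.2 (sub_ne_zero.2 hy.symm)
    obtain ⟨n, hn1, hn2⟩ := exists_mem_Ico_zpow (x := ‖x - y‖ / R) (by positivity)
      (show (1 : ℝ) < 2 by norm_num)
    rw [le_div_iff₀ hR, ← Real.rpow_intCast] at hn1
    rw [div_lt_iff₀ hR, ← Real.rpow_intCast] at hn2
    refine (ENNReal.le_tsum n).trans' ?_
    rw [Set.indicator_of_mem, mul_comm]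
    · gcongr
      rw [← ofReal_norm, ENNReal.ofReal_rpow_of_pos hxy]
      refine ENNReal.ofReal_le_ofReal (Real.rpow_le_rpow_of_nonpos (hρ0 n) ?_ (by linarith))
      simp only [hρ]
      linarith
    · rw [Metric.mem_closedBall, dist_comm, dist_eq_norm]
      simp only [hρ]
      linarith
  calc lRieszPotential μ α g x
      ≤ ∫⁻ y, ∑' n : ℤ, ENNReal.ofReal (ρ n ^ (α - D)) *
        (Metric.closedBall x (ρ (n + 1))).indicator g y ∂μ := lintegral_mono_ae hpt
    _ = ∑' n : ℤ, ENNReal.ofReal (ρ n ^ (α - D)) *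
        ∫⁻ y in Metric.closedBall x (ρ (n + 1)), g y ∂μ := by
        rw [lintegral_tsum fun n => ((hg.indicator (hB _)).const_mul _).aemeasurable]
        congr 1 with n
        rw [lintegral_const_mul _ (hg.indicator (hB _)), lintegral_indicator (hB _)]
    _ ≤ ∑' n : ℤ, ENNReal.ofReal (2 ^ D * c n) * (ENNReal.ofReal (R ^ α) * T) := by
        refine ENNReal.tsum_le_tsum fun n => ?_
        have key : ∫⁻ y in Metric.closedBall x (ρ (n + 1)), g y ∂μ ≤
            ENNReal.ofReal (ρ (n + 1) ^ D * min 1 ((2 : ℝ) ^ (-((n + 1) * β)))) * T := by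
          rcases min_choice (1 : ℝ) ((2 : ℝ) ^ (-((n + 1) * β))) with h | h
          · rw [h, mul_one]
            exact h1 _ (hρ0 _)
          · rw [h]
            convert h2 _ (hρ0 (n + 1)) using 4
            have : R / ρ (n + 1) = (2 : ℝ) ^ (-((n : ℝ) + 1)) := by
              simp only [hρ]
              push_cast
              rw [Real.rpow_neg (by norm_num)]
              field_simp
            rw [this, ← Real.rpow_mul (by norm_num)]
            ring_nf
        refine (mul_le_mul_right key _).trans (le_of_eq ?_)
        rw [← mul_assoc, ← mul_assoc, ← ENNReal.ofReal_mul (by have := hρ0 n; positivity),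
          ← ENNReal.ofReal_mul (by have := hc0 n; positivity)]
        congr 2
        have e1 : ρ n ^ (α - D) * ρ n ^ D = ρ n ^ α := by
          rw [← Real.rpow_add (hρ0 n)]
          ring_nf
        have e2 : ρ n ^ α = R ^ α * (2 : ℝ) ^ (n * α) := by
          simp only [hρ]
          rw [Real.mul_rpow hR.le (by positivity), ← Real.rpow_mul (by norm_num)]
        rw [hρs, Real.mul_rpow (by norm_num) (hρ0 n).le]
        simp only [hc]
        linear_combination (2 : ℝ) ^ D * min 1 ((2 : ℝ) ^ (-((n + 1) * β))) * (e1.trans e2)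
    _ = _ := by rw [ENNReal.tsum_mul_right, mul_assoc]

/-- The estimate `R_α (w^s) ≤ C A w^(s-1)` for a weight `w` whose power `w^s` is of class `A₁` and
in the Morrey class. -/
theorem exists_lRieszPotential_rpow_le {α s : ℝ} (hα : 0 < α) (hαd : α < Module.finrank ℝ E)
    (hs : 1 < s) (K : ℝ≥0) :
    ∃ C : ℝ≥0, ∀ w : E → ℝ≥0∞, Measurable w → ∀ (x : E) (A : ℝ≥0∞), A ≠ 0 → A ≠ ⊤ →
      w x ≠ 0 → w x ≠ ⊤ →
      (∀ ρ : ℝ, 0 < ρ → ∫⁻ y in Metric.closedBall x ρ, w y ^ s ∂μ ≤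
        K * ENNReal.ofReal (ρ ^ (Module.finrank ℝ E : ℝ)) * w x ^ s) →
      (∀ ρ : ℝ, 0 < ρ → ∫⁻ y in Metric.closedBall x ρ, w y ^ s ∂μ ≤
        K * ENNReal.ofReal (ρ ^ (Module.finrank ℝ E : ℝ)) *
          (A * ENNReal.ofReal (ρ ^ (-α))) ^ s) →
      lRieszPotential μ α (fun y => w y ^ s) x ≤ C * A * w x ^ (s - 1) := by
  obtain ⟨C, hC⟩ := exists_lRieszPotential_le μ (β := s * α) hα hαd (by nlinarith)
  refine ⟨C * K, fun w hw x A hA0 hA hw0 hwt h1 h2 => ?_⟩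
  set a : ℝ := (A / w x).toReal with ha
  have hAw : A / w x = ENNReal.ofReal a := (ENNReal.ofReal_toReal (ENNReal.div_ne_top hA hw0)).symm
  have ha0 : 0 < a := ENNReal.toReal_pos (ENNReal.div_ne_zero.2 ⟨hA0, hwt⟩)
    (ENNReal.div_ne_top hA hw0)
  have hAe : A = ENNReal.ofReal a * w x := by rw [← hAw, ENNReal.div_mul_cancel hw0 hwt]
  have hRα : (a ^ α⁻¹) ^ α = a := Real.rpow_inv_rpow ha0.le hα.ne'
  have := hC (fun y => w y ^ s) (hw.pow_const s) x (a ^ α⁻¹) (K * w x ^ s) (by positivity)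
    (fun ρ hρ => (h1 ρ hρ).trans (le_of_eq (by ring))) (fun ρ hρ => by
      refine (h2 ρ hρ).trans (le_of_eq ?_)
      have e : (a ^ α⁻¹ / ρ) ^ (s * α) = (a * ρ ^ (-α)) ^ s := by
        rw [mul_comm s, Real.rpow_mul (by positivity), Real.div_rpow (by positivity) hρ.le, hRα,
          Real.rpow_neg hρ.le, div_eq_mul_inv]
      rw [e, ENNReal.ofReal_mul (by positivity),
        ← ENNReal.ofReal_rpow_of_pos (x := a * ρ ^ (-α)) (by positivity),
        ENNReal.ofReal_mul ha0.le, hAe, ENNReal.mul_rpow_of_nonneg _ _ (by linarith),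
        ENNReal.mul_rpow_of_nonneg _ _ (by linarith), ENNReal.mul_rpow_of_nonneg _ _ (by linarith)]
      ring)
  refine this.trans (le_of_eq ?_)
  rw [hRα, ENNReal.rpow_sub _ _ hw0 hwt, ENNReal.rpow_one, hAe, div_eq_mul_inv]
  push_cast
  have : w x * (w x)⁻¹ = 1 := ENNReal.mul_inv_cancel hw0 hwt
  calc (C : ℝ≥0∞) * ENNReal.ofReal a * (K * w x ^ s)
      = C * K * ENNReal.ofReal a * w x ^ s * 1 := by ring
    _ = _ := by rw [← this]; ring

end Potential

section WeightedEstimate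

variable {E : Type*} [NormedAddCommGroup E] [MeasurableSpace E] [NormedSpace ℝ E]
  [FiniteDimensional ℝ E] [BorelSpace E] (μ : Measure E) [μ.IsAddHaarMeasure]

/-- Pointwise Hölder step of Schur's test with the weight `w`. -/
theorem lRieszPotential_rpow_le {α r t : ℝ} (hr : 1 < r) (ht : 0 < t) {w f : E → ℝ≥0∞}
    (hw : Measurable w) (hf : Measurable f) (hw0 : ∀ᵐ x ∂μ, w x ≠ 0 ∧ w x ≠ ⊤) (x : E) :
    lRieszPotential μ α f x ^ r ≤
      lRieszPotential μ α (fun y => f y ^ r * w y ^ (-(t * (r - 1)))) x *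
        lRieszPotential μ α (fun y => w y ^ t) x ^ (r - 1) := by
  have hr0 : 0 < r := by linarith
  have hr1 : 0 < r - 1 := by linarith
  have hq : r.HolderConjugate (r / (r - 1)) := Real.HolderConjugate.conjExponent hr
  have hq0 : 0 < r / (r - 1) := by positivity
  set k : E → ℝ≥0∞ := fun y => ‖x - y‖ₑ ^ (α - Module.finrank ℝ E) with hk
  have hkm : Measurable k := (measurable_const.sub measurable_id).enorm.pow_const _
  set a : ℝ := t * (r - 1) / r with ha
  have hole := ENNReal.lintegral_mul_le_Lp_mul_Lq μ hq
    (f := fun y => f y * w y ^ (-a) * k y ^ (1 / r)) (g := fun y => w y ^ a * k y ^ (1 - 1 / r))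
    ((hf.mul (hw.pow_const _)).mul (hkm.pow_const _)).aemeasurable
    ((hw.pow_const _).mul (hkm.pow_const _)).aemeasurable
  have hr' : 1 / r ≤ 1 := by rw [div_le_one hr0]; exact hr.le
  have e0 : lRieszPotential μ α f x =
      ∫⁻ y, ((fun y => f y * w y ^ (-a) * k y ^ (1 / r)) *
        (fun y => w y ^ a * k y ^ (1 - 1 / r))) y ∂μ := by
    refine lintegral_congr_ae ?_
    filter_upwards [hw0] with y ⟨hy0, hyt⟩
    have h1 : w y ^ (-a) * w y ^ a = 1 := by
      rw [← ENNReal.rpow_add _ _ hy0 hyt]; simp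
    have h2 : k y ^ (1 / r) * k y ^ (1 - 1 / r) = k y := by
      rw [← ENNReal.rpow_add_of_nonneg _ _ (by positivity) (by linarith)]; simp
    simp only [Pi.mul_apply]
    calc f y * k y = f y * (w y ^ (-a) * w y ^ a) * (k y ^ (1 / r) * k y ^ (1 - 1 / r)) := by
          rw [h1, h2, mul_one]
      _ = _ := by ring
  have e1 : ∀ y, (f y * w y ^ (-a) * k y ^ (1 / r)) ^ r =
      f y ^ r * w y ^ (-(t * (r - 1))) * k y := by
    intro y
    rw [ENNReal.mul_rpow_of_nonneg _ _ hr0.le, ENNReal.mul_rpow_of_nonneg _ _ hr0.le,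
      ← ENNReal.rpow_mul, ← ENNReal.rpow_mul, one_div_mul_cancel hr0.ne', ENNReal.rpow_one,
      neg_mul, ha, div_mul_cancel₀ _ hr0.ne']
  have e2 : ∀ y, (w y ^ a * k y ^ (1 - 1 / r)) ^ (r / (r - 1)) = w y ^ t * k y := by
    intro y
    rw [ENNReal.mul_rpow_of_nonneg _ _ hq0.le, ← ENNReal.rpow_mul, ← ENNReal.rpow_mul,
      show a * (r / (r - 1)) = t by rw [ha]; field_simp,
      show (1 - 1 / r) * (r / (r - 1)) = 1 by field_simp, ENNReal.rpow_one]
  rw [← e0] at hole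
  simp_rw [e1, e2] at hole
  calc lRieszPotential μ α f x ^ r ≤ _ := ENNReal.rpow_le_rpow hole hr0.le
    _ = _ := by
      rw [ENNReal.mul_rpow_of_nonneg _ _ hr0.le, ← ENNReal.rpow_mul, ← ENNReal.rpow_mul,
        one_div_mul_cancel hr0.ne', ENNReal.rpow_one,
        show 1 / (r / (r - 1)) * r = r - 1 by field_simp]
      rfl

theorem lRieszPotential_duality (α : ℝ) {f g : E → ℝ≥0∞} (hf : Measurable f)
    (hg : Measurable g) :
    ∫⁻ x, g x * lRieszPotential μ α f x ∂μ = ∫⁻ y, f y * lRieszPotential μ α g y ∂μ := by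
  have hk : Measurable fun z : E × E => ‖z.1 - z.2‖ₑ ^ (α - Module.finrank ℝ E) :=
    (measurable_fst.sub measurable_snd).enorm.pow_const _
  have h1 : ∀ x, g x * lRieszPotential μ α f x =
      ∫⁻ y, g x * (f y * ‖x - y‖ₑ ^ (α - Module.finrank ℝ E)) ∂μ := fun x =>
    (lintegral_const_mul _ (hf.mul (hk.comp (measurable_const.prodMk measurable_id)))).symm
  have h2 : ∀ y, f y * lRieszPotential μ α g y =
      ∫⁻ x, g x * (f y * ‖x - y‖ₑ ^ (α - Module.finrank ℝ E)) ∂μ := by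
    intro y
    have hgk : Measurable fun x => g x * ‖y - x‖ₑ ^ (α - Module.finrank ℝ E) :=
      hg.mul (hk.comp (measurable_const.prodMk measurable_id))
    refine (lintegral_const_mul _ hgk).symm.trans ?_
    refine lintegral_congr fun x => ?_
    have : ‖x - y‖ₑ = ‖y - x‖ₑ := by rw [← enorm_neg, neg_sub]
    rw [this]
    ring
  simp_rw [h1, h2]
  refine lintegral_lintegral_swap (Measurable.aemeasurable ?_)
  exact (hg.comp measurable_fst).mul ((hf.comp measurable_snd).mul hk)

/-- Schur's test for the weighted Riesz potential. -/
theorem lintegral_rpow_mul_lRieszPotential_rpow_le {α r t s : ℝ} (hr : 1 < r) (ht : 1 < t)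
    (hs : s = r + (t - 1) * (r - 1)) {w f : E → ℝ≥0∞} (hw : Measurable w) (hf : Measurable f)
    (hw0 : ∀ᵐ x ∂μ, w x ≠ 0 ∧ w x ≠ ⊤) {M : ℝ≥0∞}
    (hMt : ∀ᵐ x ∂μ, lRieszPotential μ α (fun y => w y ^ t) x ≤ M * w x ^ (t - 1))
    (hMs : ∀ᵐ x ∂μ, lRieszPotential μ α (fun y => w y ^ s) x ≤ M * w x ^ (s - 1)) :
    ∫⁻ x, w x ^ r * lRieszPotential μ α f x ^ r ∂μ ≤ M ^ r * ∫⁻ x, f x ^ r ∂μ := by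
  have hr1 : 0 < r - 1 := by linarith
  have hgm : Measurable fun y => f y ^ r * w y ^ (-(t * (r - 1))) :=
    (hf.pow_const _).mul (hw.pow_const _)
  have hIm := measurable_lRieszPotential μ α hgm
  calc ∫⁻ x, w x ^ r * lRieszPotential μ α f x ^ r ∂μ
      ≤ ∫⁻ x, M ^ (r - 1) * (w x ^ s *
          lRieszPotential μ α (fun y => f y ^ r * w y ^ (-(t * (r - 1)))) x) ∂μ := by
        refine lintegral_mono_ae ?_
        filter_upwards [hw0, hMt] with x ⟨hx0, hxt⟩ hx
        calc w x ^ r * lRieszPotential μ α f x ^ r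
            ≤ w x ^ r * (lRieszPotential μ α (fun y => f y ^ r * w y ^ (-(t * (r - 1)))) x *
              (M * w x ^ (t - 1)) ^ (r - 1)) := by
              gcongr
              refine (lRieszPotential_rpow_le μ (t := t) hr (by linarith) hw hf hw0 x).trans ?_
              gcongr
          _ = _ := by
              rw [hs, ENNReal.mul_rpow_of_nonneg _ _ hr1.le, ← ENNReal.rpow_mul,
                ENNReal.rpow_add _ _ hx0 hxt]
              ring
    _ = M ^ (r - 1) * ∫⁻ y, f y ^ r * w y ^ (-(t * (r - 1))) *
          lRieszPotential μ α (fun x => w x ^ s) y ∂μ := by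
        refine (lintegral_const_mul _ ((hw.pow_const s).mul hIm)).trans ?_
        exact congrArg _ (lRieszPotential_duality μ α hgm (hw.pow_const s))
    _ ≤ M ^ (r - 1) * ∫⁻ y, M * f y ^ r ∂μ := by
        refine mul_le_mul_right (lintegral_mono_ae ?_) _
        filter_upwards [hw0, hMs] with x ⟨hx0, hxt⟩ hx
        calc _ ≤ f x ^ r * w x ^ (-(t * (r - 1))) * (M * w x ^ (s - 1)) := by gcongr
          _ = M * f x ^ r * (w x ^ (-(t * (r - 1))) * w x ^ (s - 1)) := by ring
          _ = M * f x ^ r := by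
            rw [← ENNReal.rpow_add _ _ hx0 hxt, hs,
              show -(t * (r - 1)) + (r + (t - 1) * (r - 1) - 1) = 0 by ring, ENNReal.rpow_zero,
              mul_one]
    _ = _ := by
        rw [lintegral_const_mul _ (hf.pow_const _), ← mul_assoc]
        congr 1
        conv_rhs => rw [show r = (r - 1) + 1 by ring,
          ENNReal.rpow_add_of_nonneg _ _ hr1.le zero_le_one, ENNReal.rpow_one]

theorem setLIntegral_maximalFunction_hyp {f : E → ℝ≥0∞} (x : E) {ρ : ℝ} (hρ : 0 < ρ) :
    ∀ y ∈ Metric.closedBall x ρ, ∀ q, ρ ≤ q →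
      ∫⁻ z in Metric.closedBall y q, f z ∂μ ≤
        4 ^ Module.finrank ℝ E * maximalFunction μ f x * μ (Metric.closedBall y q) := by
  intro y hy q hq
  have hq0 : 0 < q := hρ.trans_le hq
  calc ∫⁻ z in Metric.closedBall y q, f z ∂μ
      ≤ ∫⁻ z in Metric.closedBall x (2 * q), f z ∂μ := by
        refine lintegral_mono_set (Metric.closedBall_subset_closedBall' ?_)
        have : dist y x ≤ ρ := hy
        linarith
    _ ≤ _ := setLIntegral_closedBall_le_maximalFunction μ f x (by positivity)
    _ = _ := by
        rw [measure_closedBall_mul μ x y (by norm_num) hq0.le, show (4 : ℝ≥0∞) = 2 * 2 by norm_num,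
          mul_pow]
        norm_num
        ring

/-- For `w = (M b^p)^(1/p)` and `s < p`, the power `w^s` is of class `A₁` and in the Morrey
class. -/
theorem exists_setLIntegral_maximalFunction_rpow_div_le {p s : ℝ} (hs : 0 < s) (hsp : s < p) :
    ∃ K : ℝ≥0, ∀ b : E → ℝ≥0∞, Measurable b →
      (∀ x, maximalFunction μ (fun y => b y ^ p) x ≠ 0 → maximalFunction μ (fun y => b y ^ p) x ≠ ⊤ →
        ∀ ρ : ℝ, 0 < ρ →
        ∫⁻ y in Metric.closedBall x ρ, (maximalFunction μ (fun y => b y ^ p) y ^ (1 / p)) ^ s ∂μ ≤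
          K * ENNReal.ofReal (ρ ^ (Module.finrank ℝ E : ℝ)) *
            (maximalFunction μ (fun y => b y ^ p) x ^ (1 / p)) ^ s) ∧
      ∀ (α : ℝ) (A : ℝ≥0∞), 0 < α → A ≠ 0 → A ≠ ⊤ →
        (∀ (x : E) (ρ : ℝ), 0 < ρ → ∫⁻ y in Metric.closedBall x ρ, b y ^ p ∂μ ≤
          (A * ENNReal.ofReal (ρ ^ (-α))) ^ p * μ (Metric.closedBall x ρ)) →
        ∀ (x : E) (ρ : ℝ), 0 < ρ →
        ∫⁻ y in Metric.closedBall x ρ, (maximalFunction μ (fun y => b y ^ p) y ^ (1 / p)) ^ s ∂μ ≤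
          K * ENNReal.ofReal (ρ ^ (Module.finrank ℝ E : ℝ)) *
            (A * ENNReal.ofReal (ρ ^ (-α))) ^ s := by
  have hp : 0 < p := hs.trans hsp
  have hδ : 0 < s / p := by positivity
  obtain ⟨C, hC⟩ := exists_setLIntegral_maximalFunction_rpow_le μ hδ ((div_lt_one hp).2 hsp)
  set v := μ (Metric.closedBall (0 : E) 1) with hv
  have hvt : v ≠ ⊤ := measure_closedBall_lt_top.ne
  set c : ℝ≥0∞ := (4 ^ Module.finrank ℝ E) ^ (s / p) with hc
  have hct : c ≠ ⊤ := ENNReal.rpow_ne_top_of_nonneg hδ.le (by simp)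
  have hc1 : 1 ≤ c := ENNReal.one_le_rpow (one_le_pow₀ (by norm_num)) hδ
  refine ⟨C * v.toNNReal * c.toNNReal, fun b hb => ?_⟩
  have hK : ((C * v.toNNReal * c.toNNReal : ℝ≥0) : ℝ≥0∞) = C * v * c := by
    push_cast
    rw [ENNReal.coe_toNNReal hvt, ENNReal.coe_toNNReal hct]
  rw [hK]
  have hbp : Measurable fun y => b y ^ p := hb.pow_const p
  have hpow : ∀ y, (maximalFunction μ (fun y => b y ^ p) y ^ (1 / p)) ^ s =
      maximalFunction μ (fun y => b y ^ p) y ^ (s / p) := fun y => by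
    rw [← ENNReal.rpow_mul, one_div_mul_eq_div]
  have hvol : ∀ (x : E) (ρ : ℝ), 0 < ρ → μ (Metric.closedBall x ρ) =
      ENNReal.ofReal (ρ ^ (Module.finrank ℝ E : ℝ)) * v := fun x ρ hρ => by
    rw [Measure.addHaar_closedBall' μ x hρ.le, Real.rpow_natCast]
  simp_rw [hpow]
  constructor
  · intro x hx0 hxt ρ hρ
    refine (hC _ hbp x ρ hρ (4 ^ Module.finrank ℝ E * maximalFunction μ (fun y => b y ^ p) x)
      (mul_ne_zero (by simp) hx0) (ENNReal.mul_ne_top (by simp) hxt)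
      (setLIntegral_maximalFunction_hyp μ x hρ)).trans (le_of_eq ?_)
    rw [ENNReal.mul_rpow_of_nonneg _ _ hδ.le, hvol x ρ hρ]
    ring
  · intro α A hα hA0 hAt h x ρ hρ
    refine (hC _ hbp x ρ hρ ((A * ENNReal.ofReal (ρ ^ (-α))) ^ p) ?_ ?_ ?_).trans ?_
    · have : ENNReal.ofReal (ρ ^ (-α)) ≠ 0 := by
        rw [Ne, ENNReal.ofReal_eq_zero, not_le]; positivity
      simp [ENNReal.rpow_eq_zero_iff, hA0, this, hp.not_gt]
    · exact ENNReal.rpow_ne_top_of_nonneg hp.le (ENNReal.mul_ne_top hAt ENNReal.ofReal_ne_top)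
    · intro y _ q hq
      refine (h y q (hρ.trans_le hq)).trans ?_
      gcongr ?_ * _
      refine ENNReal.rpow_le_rpow ?_ hp.le
      gcongr A * ?_
      exact ENNReal.ofReal_le_ofReal (Real.rpow_le_rpow_of_nonpos hρ hq (neg_nonpos.2 hα.le))
    · rw [← ENNReal.rpow_mul, mul_div_cancel₀ _ hp.ne', hvol x ρ hρ]
      calc _ = C * v * 1 * ENNReal.ofReal (ρ ^ (Module.finrank ℝ E : ℝ)) *
            (A * ENNReal.ofReal (ρ ^ (-α))) ^ s := by ring
        _ ≤ _ := by gcongr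

theorem ae_eq_zero_of_setLIntegral_closedBall_rpow {p : ℝ} (hp : 0 < p) {b : E → ℝ≥0∞}
    (hb : Measurable b) (x : E)
    (h : ∀ ρ : ℝ, 0 < ρ → ∫⁻ y in Metric.closedBall x ρ, b y ^ p ∂μ = 0) : ∀ᵐ y ∂μ, b y = 0 := by
  have hn : ∀ n : ℕ, ∀ᵐ y ∂μ, y ∈ Metric.closedBall x ((n : ℝ) + 1) → b y = 0 := by
    intro n
    have := (lintegral_eq_zero_iff (hb.pow_const p)).1 (h (n + 1) (by positivity))
    rw [Filter.EventuallyEq, ae_restrict_iff' Metric.isClosed_closedBall.measurableSet] at this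
    filter_upwards [this] with y hy hyB
    simpa [ENNReal.rpow_eq_zero_iff, hp, hp.not_gt] using hy hyB
  filter_upwards [ae_all_iff.2 hn] with y hy
  obtain ⟨n, hn⟩ := exists_nat_ge (dist y x)
  exact hy n (by rw [Metric.mem_closedBall]; linarith)

/-- The Chiarenza–Frasca (Fefferman–Phong) inequality for Riesz potentials of nonnegative
functions. -/
theorem exists_lintegral_rpow_mul_lRieszPotential_rpow_le {α r p : ℝ} (hr : 1 < r) (hrp : r < p)
    (hα : 0 < α) (hαd : α < Module.finrank ℝ E) :
    ∃ C : ℝ≥0, ∀ b f : E → ℝ≥0∞, Measurable b → Measurable f → ∀ A : ℝ≥0∞, A ≠ ⊤ →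
      (∀ (x : E) (ρ : ℝ), 0 < ρ → ∫⁻ y in Metric.closedBall x ρ, b y ^ p ∂μ ≤
        (A * ENNReal.ofReal (ρ ^ (-α))) ^ p * μ (Metric.closedBall x ρ)) →
      ∫⁻ x, b x ^ r * lRieszPotential μ α f x ^ r ∂μ ≤ C * A ^ r * ∫⁻ x, f x ^ r ∂μ := by
  have hp : 0 < p := by linarith
  have hr0 : 0 < r := by linarith
  set τ : ℝ := (p - r) / (2 * p) with hτ
  have hτ0 : 0 < τ := div_pos (by linarith) (by positivity)
  have hτp : τ * (2 * p) = p - r := div_mul_cancel₀ _ (by positivity)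
  set t : ℝ := 1 + τ with ht
  set s : ℝ := r + (t - 1) * (r - 1) with hs
  have ht1 : 1 < t := by linarith
  have htp : t < p := by nlinarith
  have hs1 : 1 < s := by nlinarith
  have hsp : s < p := by nlinarith
  obtain ⟨Kt, hKt⟩ := exists_setLIntegral_maximalFunction_rpow_div_le μ (by linarith) htp
  obtain ⟨Ks, hKs⟩ := exists_setLIntegral_maximalFunction_rpow_div_le μ (by linarith) hsp
  obtain ⟨Ct, hCt⟩ := exists_lRieszPotential_rpow_le μ hα hαd ht1 Kt
  obtain ⟨Cs, hCs⟩ := exists_lRieszPotential_rpow_le μ hα hαd hs1 Ks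
  refine ⟨(Ct + Cs) ^ r, fun b f hb hf A hA h => ?_⟩
  have hzero : (∀ᵐ y ∂μ, b y = 0) →
      ∫⁻ x, b x ^ r * lRieszPotential μ α f x ^ r ∂μ ≤
        ((Ct + Cs) ^ r : ℝ≥0) * A ^ r * ∫⁻ x, f x ^ r ∂μ := by
    intro h0
    rw [lintegral_congr_ae (g := fun _ => 0)]
    · simp
    · filter_upwards [h0] with x hx
      simp [hx, hr0]
  rcases eq_or_ne A 0 with rfl | hA0
  · refine hzero (ae_eq_zero_of_setLIntegral_closedBall_rpow μ hp hb 0 fun ρ hρ => ?_)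
    simpa [hp] using h 0 ρ hρ
  set W := maximalFunction μ fun y => b y ^ p with hW
  have hWm : Measurable W := measurable_maximalFunction μ (hb.pow_const p)
  by_cases hx0 : ∃ x, W x = 0
  · obtain ⟨x, hx⟩ := hx0
    refine hzero (ae_eq_zero_of_setLIntegral_closedBall_rpow μ hp hb x fun ρ hρ => ?_)
    have := setLIntegral_closedBall_le_maximalFunction μ (fun y => b y ^ p) x hρ
    rw [← hW, hx] at this
    simpa using this
  push Not at hx0
  set w : E → ℝ≥0∞ := fun y => W y ^ (1 / p) with hw
  have hwm : Measurable w := hWm.pow_const _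
  have hWt : ∀ᵐ x ∂μ, W x ≠ ⊤ := by
    have hn : ∀ n : ℕ, ∀ᵐ y ∂μ, y ∈ Metric.closedBall (0 : E) ((n : ℝ) + 1) → W y ≠ ⊤ := by
      intro n
      have hle := (hKs b hb).2 α A hα hA0 hA h 0 (n + 1) (by positivity)
      have hfin : ∫⁻ y in Metric.closedBall (0 : E) ((n : ℝ) + 1), w y ^ s ∂μ ≠ ⊤ := by
        refine ne_top_of_le_ne_top ?_ hle
        exact ENNReal.mul_ne_top (ENNReal.mul_ne_top (by simp) ENNReal.ofReal_ne_top)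
          (ENNReal.rpow_ne_top_of_nonneg (by linarith)
            (ENNReal.mul_ne_top hA ENNReal.ofReal_ne_top))
      have := ae_lt_top (hwm.pow_const s) hfin
      rw [ae_restrict_iff' Metric.isClosed_closedBall.measurableSet] at this
      filter_upwards [this] with y hy hyB htop
      have h1 := hy hyB
      rw [hw] at h1
      simp only [htop] at h1
      rw [ENNReal.top_rpow_of_pos (by positivity), ENNReal.top_rpow_of_pos (by linarith)] at h1
      exact lt_irrefl _ h1
    filter_upwards [ae_all_iff.2 hn] with y hy
    obtain ⟨n, hn⟩ := exists_nat_ge (dist y 0)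
    exact hy n (by rw [Metric.mem_closedBall]; linarith)
  have hw0 : ∀ᵐ x ∂μ, w x ≠ 0 ∧ w x ≠ ⊤ := by
    filter_upwards [hWt] with x hx
    refine ⟨?_, ENNReal.rpow_ne_top_of_nonneg (by positivity) hx⟩
    simp [hw, ENNReal.rpow_eq_zero_iff, hx0 x, hx]
  have hle : ∀ᵐ x ∂μ, b x ≤ w x := by
    have hfin : ∀ ρ : ℝ, ∫⁻ y in Metric.closedBall 0 ρ, b y ^ p ∂μ ≠ ⊤ := by
      intro ρ
      refine ne_top_of_le_ne_top ?_ ((lintegral_mono_set (Metric.closedBall_subset_closedBall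
        (le_max_left ρ 1))).trans (h 0 (max ρ 1) (by positivity)))
      exact ENNReal.mul_ne_top (ENNReal.rpow_ne_top_of_nonneg hp.le
        (ENNReal.mul_ne_top hA ENNReal.ofReal_ne_top)) measure_closedBall_lt_top.ne
    filter_upwards [ae_le_maximalFunction μ (hb.pow_const p) hfin] with x hx
    calc b x = (b x ^ p) ^ (1 / p) := by
          rw [← ENNReal.rpow_mul, mul_one_div_cancel hp.ne', ENNReal.rpow_one]
      _ ≤ w x := ENNReal.rpow_le_rpow hx (by positivity)
  have hMt : ∀ᵐ x ∂μ, lRieszPotential μ α (fun y => w y ^ t) x ≤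
      ((Ct + Cs : ℝ≥0) * A) * w x ^ (t - 1) := by
    filter_upwards [hWt, hw0] with x hx ⟨hx1, hx2⟩
    refine (hCt w hwm x A hA0 hA hx1 hx2 ((hKt b hb).1 x (hx0 x) hx)
      ((hKt b hb).2 α A hα hA0 hA h x)).trans ?_
    gcongr
    exact le_add_of_nonneg_right zero_le
  have hMs : ∀ᵐ x ∂μ, lRieszPotential μ α (fun y => w y ^ s) x ≤
      ((Ct + Cs : ℝ≥0) * A) * w x ^ (s - 1) := by
    filter_upwards [hWt, hw0] with x hx ⟨hx1, hx2⟩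
    refine (hCs w hwm x A hA0 hA hx1 hx2 ((hKs b hb).1 x (hx0 x) hx)
      ((hKs b hb).2 α A hα hA0 hA h x)).trans ?_
    gcongr
    exact le_add_of_nonneg_left zero_le
  calc ∫⁻ x, b x ^ r * lRieszPotential μ α f x ^ r ∂μ
      ≤ ∫⁻ x, w x ^ r * lRieszPotential μ α f x ^ r ∂μ := by
        refine lintegral_mono_ae ?_
        filter_upwards [hle] with x hx
        gcongr
    _ ≤ ((Ct + Cs : ℝ≥0) * A) ^ r * ∫⁻ x, f x ^ r ∂μ :=
        lintegral_rpow_mul_lRieszPotential_rpow_le μ hr ht1 hs hwm hf hw0 hMt hMs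
    _ = _ := by
        rw [ENNReal.mul_rpow_of_nonneg _ _ hr0.le, ENNReal.coe_rpow_of_nonneg _ hr0.le]

end WeightedEstimate

section GradientRepresentation

open Filter Topology

variable {E : Type*} [NormedAddCommGroup E] [MeasurableSpace E] [NormedSpace ℝ E]
  [FiniteDimensional ℝ E] [BorelSpace E] (μ : Measure E) [μ.IsAddHaarMeasure]

theorem lintegral_comp_smul_of_pos {φ : E → ℝ≥0∞} (hφ : Measurable φ) {s : ℝ} (hs : 0 < s) :
    ∫⁻ z, φ (s • z) ∂μ = ENNReal.ofReal (s ^ (-(Module.finrank ℝ E : ℝ))) * ∫⁻ y, φ y ∂μ := by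
  rw [← lintegral_map hφ (measurable_const_smul s), Measure.map_addHaar_smul μ hs.ne',
    lintegral_smul_measure, abs_of_pos (by positivity), Real.rpow_neg hs.le, Real.rpow_natCast,
    smul_eq_mul]

theorem enorm_le_lintegral_Ioi_fderiv {u : E → ℝ} (hu : ContDiff ℝ 1 u) (hc : HasCompactSupport u)
    (x : E) {z : E} (hz : z ≠ 0) :
    ‖u x‖ₑ ≤ ∫⁻ s in Set.Ioi (0 : ℝ), ‖fderiv ℝ u (x + s • z)‖ₑ * ‖z‖ₑ := by
  set γ : ℝ → E := fun s => x + s • z with hγ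
  have hγc : Continuous γ := by fun_prop
  have hd : ∀ s, HasDerivAt (fun s => u (γ s)) (fderiv ℝ u (γ s) z) s := fun s => by
    have h1 : HasDerivAt γ z s := by
      have := ((hasDerivAt_id s).smul_const z).const_add x
      rw [one_smul] at this
      exact this
    exact ((hu.differentiable one_ne_zero).differentiableAt.hasFDerivAt).comp_hasDerivAt s h1
  have hcl : IsClosedEmbedding γ :=
    (Homeomorph.addLeft x).isClosedEmbedding.comp
      (isClosedEmbedding_smul_left (𝕜 := ℝ) hz)
  have hcont : Continuous fun s => fderiv ℝ u (γ s) z :=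
    ((hu.continuous_fderiv one_ne_zero).comp hγc).clm_apply continuous_const
  have hsupp : HasCompactSupport fun s => fderiv ℝ u (γ s) z :=
    ((hc.fderiv ℝ).comp_isClosedEmbedding hcl).comp_left (g := fun L : E →L[ℝ] ℝ => L z) rfl
  have hint := hcont.integrable_of_hasCompactSupport (μ := volume) hsupp
  have hlim : Tendsto (fun s => u (γ s)) atTop (𝓝 0) := by
    have := (hc.comp_isClosedEmbedding hcl).is_zero_at_infty
    exact this.mono_left atTop_le_cocompact
  have key := integral_Ioi_of_hasDerivAt_of_tendsto (a := 0) (hd 0).continuousAt.continuousWithinAt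
    (fun s _ => hd s) hint.integrableOn hlim
  have hx : u x = -∫ s in Set.Ioi (0 : ℝ), fderiv ℝ u (γ s) z := by
    rw [key]; simp [hγ]
  rw [hx, enorm_neg]
  refine (enorm_integral_le_lintegral_enorm _).trans (lintegral_mono fun s => ?_)
  exact ContinuousLinearMap.le_opENorm _ _

theorem lintegral_Ioi_indicator_rpow_le {a D : ℝ} (ha : 0 < a) (hD : 0 ≤ D) :
    ∫⁻ s in Set.Ioi (0 : ℝ), ENNReal.ofReal (s ^ (-D)) *
      (Set.Ioo (a / 2) a).indicator 1 s ≤ ENNReal.ofReal (2 ^ D) * ENNReal.ofReal a ^ (1 - D) := by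
  calc _ ≤ ∫⁻ s, (Set.Ioo (a / 2) a).indicator (fun _ => ENNReal.ofReal ((a / 2) ^ (-D))) s := by
        refine (setLIntegral_le_lintegral _ _).trans (lintegral_mono fun s => ?_)
        by_cases hs : s ∈ Set.Ioo (a / 2) a
        · simp only [Set.indicator_of_mem hs, Pi.one_apply, mul_one]
          exact ENNReal.ofReal_le_ofReal
            (Real.rpow_le_rpow_of_nonpos (by positivity) hs.1.le (by linarith))
        · simp [Set.indicator_of_notMem hs]
    _ = ENNReal.ofReal ((a / 2) ^ (-D) * (a / 2)) := by
        rw [lintegral_indicator_const measurableSet_Ioo, Real.volume_Ioo,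
          ENNReal.ofReal_mul (by positivity)]
        ring_nf
    _ ≤ ENNReal.ofReal (2 ^ D * a ^ (1 - D)) := by
        refine ENNReal.ofReal_le_ofReal ?_
        have h1 : (a / 2) ^ (-D) = 2 ^ D * a ^ (-D) := by
          rw [Real.div_rpow ha.le (by norm_num), Real.rpow_neg (x := 2) (by norm_num)]
          field_simp
        have h2 : a ^ (1 - D) = a ^ (-D) * a := by
          rw [← Real.rpow_add_one ha.ne']; ring_nf
        rw [h1, h2]
        have : 0 ≤ (2 : ℝ) ^ D * a ^ (-D) * a := by positivity
        nlinarith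
    _ = _ := by rw [ENNReal.ofReal_mul (by positivity), ENNReal.ofReal_rpow_of_pos ha]

/-- A compactly supported `C¹` function is controlled by the Riesz potential of order one of its
gradient. -/
theorem exists_enorm_le_lRieszPotential_fderiv [Nontrivial E] :
    ∃ C : ℝ≥0, ∀ u : E → ℝ, ContDiff ℝ 1 u → HasCompactSupport u → ∀ x,
      ‖u x‖ₑ ≤ C * lRieszPotential μ 1 (fun y => ‖fderiv ℝ u y‖ₑ) x := by
  set D : ℝ := (Module.finrank ℝ E : ℝ) with hD
  have hD0 : 0 ≤ D := Nat.cast_nonneg _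
  set S : Set E := {z | 1 < ‖z‖ ∧ ‖z‖ < 2} with hS
  have hSo : IsOpen S :=
    (isOpen_lt continuous_const continuous_norm).inter (isOpen_lt continuous_norm continuous_const)
  have hSm : MeasurableSet S := hSo.measurableSet
  have hS0 : μ S ≠ 0 := by
    obtain ⟨z, hz⟩ := exists_norm_eq E (show (0 : ℝ) ≤ 3 / 2 by norm_num)
    exact (hSo.measure_pos μ ⟨z, by rw [hS, Set.mem_ofPred_eq, hz]; norm_num⟩).ne'
  have hSt : μ S ≠ ⊤ := by
    refine ne_top_of_le_ne_top (measure_closedBall_lt_top (x := (0 : E)) (r := 2)).ne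
      (measure_mono fun z hz => ?_)
    simpa using hz.2.le
  set C : ℝ≥0∞ := (μ S)⁻¹ * (2 * ENNReal.ofReal (2 ^ D)) with hC
  have hCt : C ≠ ⊤ := ENNReal.mul_ne_top (ENNReal.inv_ne_top.2 hS0)
    (ENNReal.mul_ne_top (by simp) ENNReal.ofReal_ne_top)
  refine ⟨C.toNNReal, fun u hu hc x => ?_⟩
  rw [ENNReal.coe_toNNReal hCt]
  set F : E → ℝ≥0∞ := fun y => ‖fderiv ℝ u y‖ₑ with hF
  have hFm : Measurable F := (hu.continuous_fderiv one_ne_zero).enorm.measurable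
  have hmain : μ S * ‖u x‖ₑ ≤
      2 * (ENNReal.ofReal (2 ^ D) * lRieszPotential μ 1 F x) := by
    calc μ S * ‖u x‖ₑ = ∫⁻ z in S, ‖u x‖ₑ ∂μ := by rw [setLIntegral_const, mul_comm]
      _ ≤ ∫⁻ z in S, (2 * ∫⁻ s in Set.Ioi (0 : ℝ), F (x + s • z)) ∂μ := by
          refine setLIntegral_mono' hSm fun z hz => ?_
          have hz0 : z ≠ 0 := by
            rintro rfl
            simp [hS] at hz
            linarith
          refine (enorm_le_lintegral_Ioi_fderiv hu hc x hz0).trans ?_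
          rw [lintegral_mul_const' _ _ enorm_ne_top, mul_comm]
          gcongr
          rw [← ofReal_norm, ← ENNReal.ofReal_ofNat]
          exact ENNReal.ofReal_le_ofReal hz.2.le
      _ = 2 * ∫⁻ z, (∫⁻ s in Set.Ioi (0 : ℝ), S.indicator 1 z * F (x + s • z)) ∂μ := by
          rw [lintegral_const_mul' _ _ (by simp), ← lintegral_indicator hSm]
          congr 2 with z
          by_cases hz : z ∈ S <;> simp [hz]
      _ = 2 * ∫⁻ s in Set.Ioi (0 : ℝ), ∫⁻ z, S.indicator 1 z * F (x + s • z) ∂μ := by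
          rw [lintegral_lintegral_swap]
          refine Measurable.aemeasurable ?_
          exact ((measurable_one.indicator hSm).comp measurable_fst).mul
            (hFm.comp (measurable_const.add (measurable_snd.smul measurable_fst)))
      _ = 2 * ∫⁻ s in Set.Ioi (0 : ℝ), ∫⁻ y, ENNReal.ofReal (s ^ (-D)) *
            (Set.Ioo (‖y‖ / 2) ‖y‖).indicator 1 s * F (x + y) ∂μ := by
          congr 1
          refine setLIntegral_congr_fun measurableSet_Ioi fun s hs => ?_
          have hs : 0 < s := hs
          have hφ : Measurable fun y => S.indicator (1 : E → ℝ≥0∞) (s⁻¹ • y) * F (x + y) :=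
            ((measurable_one.indicator hSm).comp (measurable_const_smul _)).mul
              (hFm.comp (measurable_const_add x))
          have h1 := lintegral_comp_smul_of_pos μ hφ hs
          simp only [inv_smul_smul₀ hs.ne'] at h1
          rw [h1, ← lintegral_const_mul _ hφ]
          refine lintegral_congr fun y => ?_
          rw [mul_assoc]
          congr 2
          have : s⁻¹ • y ∈ S ↔ s ∈ Set.Ioo (‖y‖ / 2) ‖y‖ := by
            rw [hS, Set.mem_ofPred_eq, norm_smul, norm_inv, Real.norm_of_nonneg hs.le,
              inv_mul_eq_div, one_lt_div hs, div_lt_iff₀ hs, Set.mem_Ioo, div_lt_iff₀ two_pos,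
              and_comm, mul_comm]
          by_cases h : s⁻¹ • y ∈ S
          · simp only [Set.indicator_of_mem h, Set.indicator_of_mem (this.1 h), Pi.one_apply]
          · rw [Set.indicator_of_notMem h, Set.indicator_of_notMem (mt this.2 h)]
      _ = 2 * ∫⁻ y, (∫⁻ s in Set.Ioi (0 : ℝ), ENNReal.ofReal (s ^ (-D)) *
            (Set.Ioo (‖y‖ / 2) ‖y‖).indicator 1 s) * F (x + y) ∂μ := by
          rw [lintegral_lintegral_swap]
          · congr 2 with y
            rw [lintegral_mul_const]
            exact (measurable_id.pow_const _).ennreal_ofReal.mul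
              (measurable_one.indicator measurableSet_Ioo)
          · refine Measurable.aemeasurable ?_
            have hset : MeasurableSet {z : ℝ × E | ‖z.2‖ / 2 < z.1 ∧ z.1 < ‖z.2‖} :=
              (measurableSet_lt (measurable_snd.norm.div_const 2) measurable_fst).inter
                (measurableSet_lt measurable_fst measurable_snd.norm)
            exact ((measurable_fst.pow_const _).ennreal_ofReal.mul
              ((measurable_one (α := ℝ≥0∞)).indicator hset)).mul
                (hFm.comp (measurable_snd.const_add x))
      _ ≤ 2 * ∫⁻ y, ENNReal.ofReal (2 ^ D) * (F (x + y) * ‖y‖ₑ ^ (1 - D)) ∂μ := by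
          refine mul_le_mul_right (lintegral_mono_ae ?_) _
          have hne : ∀ᵐ y ∂μ, y ≠ 0 := by simp [ae_iff, measure_singleton]
          filter_upwards [hne] with y hy
          calc _ ≤ ENNReal.ofReal (2 ^ D) * ENNReal.ofReal ‖y‖ ^ (1 - D) * F (x + y) := by
                gcongr
                exact lintegral_Ioi_indicator_rpow_le (norm_pos_iff.2 hy) hD0
            _ = _ := by rw [ofReal_norm]; ring
      _ = 2 * (ENNReal.ofReal (2 ^ D) * lRieszPotential μ 1 F x) := by
          rw [lintegral_const_mul' _ _ ENNReal.ofReal_ne_top, lRieszPotential,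
            ← lintegral_add_left_eq_self (fun y => F y * ‖x - y‖ₑ ^ _) x]
          congr 3 with y
          simp [hD]
  calc ‖u x‖ₑ = (μ S)⁻¹ * (μ S * ‖u x‖ₑ) := by
        rw [← mul_assoc, ENNReal.inv_mul_cancel hS0 hSt, one_mul]
    _ ≤ (μ S)⁻¹ * (2 * (ENNReal.ofReal (2 ^ D) * lRieszPotential μ 1 F x)) := by gcongr
    _ = _ := by rw [hC]; ring

end GradientRepresentation

section Euclidean

theorem setLIntegral_closedBall_le_of_morreyNorm_le {d : ℕ} [NeZero d] {p α : ℝ} (hp : 0 < p)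
    {b : EuclideanSpace ℝ (Fin d) → ℝ} {A : ℝ≥0∞} (hA : morreyNorm d p α b ≤ A)
    (x : EuclideanSpace ℝ (Fin d)) {ρ : ℝ} (hρ : 0 < ρ) :
    ∫⁻ y in Metric.closedBall x ρ, ‖b y‖ₑ ^ p ≤
      (A * ENNReal.ofReal (ρ ^ (-α))) ^ p * volume (Metric.closedBall x ρ) := by
  have hball : (Metric.closedBall x ρ : Set (EuclideanSpace ℝ (Fin d))) =ᵐ[volume]
      Metric.ball x ρ := by
    refine (ae_eq_of_subset_of_measure_ge Metric.ball_subset_closedBall ?_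
      Metric.isOpen_ball.measurableSet.nullMeasurableSet measure_closedBall_lt_top.ne).symm
    exact (Measure.addHaar_closedBall_eq_addHaar_ball volume x ρ).le
  rw [setLIntegral_congr hball, measure_congr hball]
  set a := ⨍⁻ y in Metric.ball x ρ, ‖b y‖ₑ ^ p ∂volume with ha
  have h1 : ENNReal.ofReal (ρ ^ α) * a ^ (1 / p) ≤ A := by
    refine le_trans ?_ hA
    refine le_iSup₂_of_le ρ hρ ?_
    gcongr
    exact le_iSup (fun x : EuclideanSpace ℝ (Fin d) =>
      (⨍⁻ y in Metric.ball x ρ, ‖b y‖ₑ ^ p ∂volume) ^ (1 / p)) x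
  have h2 : a ^ (1 / p) ≤ A * ENNReal.ofReal (ρ ^ (-α)) := by
    calc a ^ (1 / p) = ENNReal.ofReal (ρ ^ α) * a ^ (1 / p) * ENNReal.ofReal (ρ ^ (-α)) := by
          rw [mul_right_comm, ← ENNReal.ofReal_mul (by positivity), ← Real.rpow_add hρ]
          simp
      _ ≤ _ := by gcongr
  have h3 : a ≤ (A * ENNReal.ofReal (ρ ^ (-α))) ^ p := by
    calc a = (a ^ (1 / p)) ^ p := by
          rw [← ENNReal.rpow_mul, one_div_mul_cancel hp.ne', ENNReal.rpow_one]
      _ ≤ _ := ENNReal.rpow_le_rpow h2 hp.le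
  have h4 : ∫⁻ y in Metric.ball x ρ, ‖b y‖ₑ ^ p = a * volume (Metric.ball x ρ) := by
    rw [ha, setLAverage_eq, ENNReal.div_mul_cancel (Metric.measure_ball_pos _ _ hρ).ne'
      measure_ball_lt_top.ne]
  rw [h4]
  gcongr

theorem exists_lintegral_enorm_rpow_mul_lRieszPotential_le {d : ℕ} {α r p : ℝ} (hr : 1 < r)
    (hrp : r < p) (hα : 0 < α) (hαd : α < d) :
    ∃ N : ℝ≥0, ∀ (b : EuclideanSpace ℝ (Fin d) → ℝ) (f : EuclideanSpace ℝ (Fin d) → ℝ≥0∞)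
      (A : ℝ≥0∞), AEMeasurable b volume → AEMeasurable f volume → morreyNorm d p α b ≤ A →
      ∫⁻ x, ‖b x‖ₑ ^ r * lRieszPotential volume α f x ^ r ≤
        (N : ℝ≥0∞) * A ^ r * ∫⁻ x, f x ^ r := by
  have hr0 : 0 < r := by linarith
  have : NeZero d := ⟨by rintro rfl; norm_num at hαd; linarith⟩
  obtain ⟨C, hC⟩ := exists_lintegral_rpow_mul_lRieszPotential_rpow_le
    (volume : Measure (EuclideanSpace ℝ (Fin d))) hr hrp hα (by simpa using hαd)
  refine ⟨C + 1, fun b f A hb hf hA => ?_⟩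
  have hpot : ∀ x, lRieszPotential volume α f x = lRieszPotential volume α (hf.mk f) x := fun x =>
    lintegral_congr_ae (by filter_upwards [hf.ae_eq_mk] with y hy; rw [hy])
  rcases eq_or_ne A ⊤ with rfl | hAt
  · rcases eq_or_ne (∫⁻ x, f x ^ r) 0 with h0 | h0
    · have hf0 : ∀ᵐ y, f y = 0 := by
        filter_upwards [(lintegral_eq_zero_iff' (hf.pow_const r)).1 h0] with y hy
        simpa [ENNReal.rpow_eq_zero_iff, hr0, hr0.not_gt] using hy
      have : ∀ x, lRieszPotential volume α f x = 0 := fun x => by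
        rw [lRieszPotential, lintegral_congr_ae (g := fun _ => 0)
          (by filter_upwards [hf0] with y hy; simp [hy]), lintegral_zero]
      simp [this, hr0]
    · rw [ENNReal.top_rpow_of_pos hr0, ENNReal.mul_top (by simp), ENNReal.top_mul h0]
      exact le_top
  · have hbm := hb.enorm
    have hbe := hbm.ae_eq_mk
    have := hC (hbm.mk _) (hf.mk f) hbm.measurable_mk hf.measurable_mk A hAt (fun x ρ hρ => by
      refine le_of_eq_of_le (lintegral_congr_ae (ae_restrict_of_ae ?_))
        (setLIntegral_closedBall_le_of_morreyNorm_le (by linarith) hA x hρ)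
      filter_upwards [hbe] with y hy
      rw [← hy])
    calc ∫⁻ x, ‖b x‖ₑ ^ r * lRieszPotential volume α f x ^ r
        = ∫⁻ x, hbm.mk _ x ^ r * lRieszPotential volume α (hf.mk f) x ^ r := by
          refine lintegral_congr_ae ?_
          filter_upwards [hbe] with x hx
          rw [← hx, hpot]
      _ ≤ C * A ^ r * ∫⁻ x, hf.mk f x ^ r := this
      _ = C * A ^ r * ∫⁻ x, f x ^ r := by
          congr 1
          refine lintegral_congr_ae ?_
          filter_upwards [hf.ae_eq_mk] with x hx
          rw [← hx]
      _ ≤ _ := by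
          gcongr
          exact le_add_of_nonneg_right zero_le

theorem enorm_div_norm_rpow_le {d : ℕ} {α : ℝ} (hαd : α < d) (c : ℝ)
    (z : EuclideanSpace ℝ (Fin d)) :
    ‖c / ‖z‖ ^ ((d : ℝ) - α)‖ₑ ≤
      ‖c‖ₑ * ‖z‖ₑ ^ (α - Module.finrank ℝ (EuclideanSpace ℝ (Fin d))) := by
  rcases eq_or_ne z 0 with rfl | hz
  · rw [norm_zero, Real.zero_rpow (by linarith)]
    simp
  · have hz' : 0 < ‖z‖ := norm_pos_iff.2 hz
    rw [div_eq_mul_inv, ← Real.rpow_neg hz'.le, enorm_mul,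
      Real.enorm_of_nonneg (Real.rpow_nonneg hz'.le _), ← ENNReal.ofReal_rpow_of_pos hz', ofReal_norm, finrank_euclideanSpace_fin, neg_sub]

theorem enorm_rieszPotential_le {d : ℕ} {α : ℝ} (hαd : α < d)
    (f : EuclideanSpace ℝ (Fin d) → ℝ) (x : EuclideanSpace ℝ (Fin d)) :
    ‖rieszPotential d α f x‖ₑ ≤ lRieszPotential volume α (fun y => ‖f y‖ₑ) x :=
  (enorm_integral_le_lintegral_enorm _).trans
    (lintegral_mono fun y => enorm_div_norm_rpow_le hαd (f y) (x - y))

theorem integrable_div_norm_rpow {d : ℕ} {α : ℝ} (hαd : α < d)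
    {f : EuclideanSpace ℝ (Fin d) → ℝ} (hf : AEStronglyMeasurable f volume)
    {x : EuclideanSpace ℝ (Fin d)} (hx : lRieszPotential volume α (fun y => ‖f y‖ₑ) x ≠ ⊤) :
    Integrable (fun y => f y / ‖x - y‖ ^ ((d : ℝ) - α)) volume := by
  refine ⟨(hf.aemeasurable.div (Measurable.aemeasurable ?_)).aestronglyMeasurable, ?_⟩
  · exact (measurable_const.sub measurable_id).norm.pow_const _
  · exact (lintegral_mono fun y => enorm_div_norm_rpow_le hαd (f y) (x - y)).trans_lt hx.lt_top

theorem gradNorm_nonneg {d : ℕ} (u : EuclideanSpace ℝ (Fin d) → ℝ)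
    (x : EuclideanSpace ℝ (Fin d)) : 0 ≤ gradNorm d u x :=
  Real.sqrt_nonneg _

theorem hessNorm_nonneg {d : ℕ} (u : EuclideanSpace ℝ (Fin d) → ℝ)
    (x : EuclideanSpace ℝ (Fin d)) : 0 ≤ hessNorm d u x :=
  Real.sqrt_nonneg _

theorem enorm_fderiv_le_enorm_gradNorm {d : ℕ} (u : EuclideanSpace ℝ (Fin d) → ℝ)
    (x : EuclideanSpace ℝ (Fin d)) : ‖fderiv ℝ u x‖ₑ ≤ ‖gradNorm d u x‖ₑ := by
  rw [Real.enorm_of_nonneg (gradNorm_nonneg _ _), ← ofReal_norm]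
  refine ENNReal.ofReal_le_ofReal (ContinuousLinearMap.opNorm_le_bound _ (Real.sqrt_nonneg _)
    fun v => ?_)
  have hv : fderiv ℝ u x v = ∑ i, fderiv ℝ u x (EuclideanSpace.single i 1) * v i := by
    conv_lhs => rw [← (EuclideanSpace.basisFun (Fin d) ℝ).sum_repr v]
    simp [map_sum, mul_comm]
  rw [hv, EuclideanSpace.norm_eq, Real.norm_eq_abs]
  rw [gradNorm]
  refine abs_le_of_sq_le_sq ?_ (by positivity)
  rw [mul_pow, Real.sq_sqrt (by positivity), Real.sq_sqrt (by positivity)]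
  simpa using Finset.sum_mul_sq_le_sq_mul_sq Finset.univ
    (fun i => fderiv ℝ u x (EuclideanSpace.single i 1)) (fun i => v i)

theorem continuous_gradNorm {d : ℕ} {u : EuclideanSpace ℝ (Fin d) → ℝ} (hu : ContDiff ℝ ∞ u) :
    Continuous (gradNorm d u) := by
  refine Real.continuous_sqrt.comp (continuous_finsetSum _ fun i _ => ?_)
  exact (((hu.continuous_fderiv (by simp)).clm_apply continuous_const)).pow 2

theorem contDiff_fderiv_single {d : ℕ} {u : EuclideanSpace ℝ (Fin d) → ℝ} (hu : ContDiff ℝ ∞ u)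
    (j : Fin d) : ContDiff ℝ ∞ fun y => fderiv ℝ u y (EuclideanSpace.single j 1) :=
  (hu.fderiv_right (m := ∞) (by simp)).clm_apply contDiff_const

theorem continuous_hessNorm {d : ℕ} {u : EuclideanSpace ℝ (Fin d) → ℝ} (hu : ContDiff ℝ ∞ u) :
    Continuous (hessNorm d u) := by
  refine Real.continuous_sqrt.comp (continuous_finsetSum _ fun i _ =>
    continuous_finsetSum _ fun j _ => ?_)
  exact ((((contDiff_fderiv_single hu j).continuous_fderiv (by simp)).clm_apply
    continuous_const)).pow 2

theorem gradNorm_fderiv_single_le_hessNorm {d : ℕ} (u : EuclideanSpace ℝ (Fin d) → ℝ) (j : Fin d)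
    (x : EuclideanSpace ℝ (Fin d)) :
    gradNorm d (fun y => fderiv ℝ u y (EuclideanSpace.single j 1)) x ≤ hessNorm d u x := by
  refine Real.sqrt_le_sqrt (Finset.sum_le_sum fun i _ => ?_)
  exact Finset.single_le_sum (f := fun j => (fderiv ℝ
    (fun y => fderiv ℝ u y (EuclideanSpace.single j 1)) x (EuclideanSpace.single i 1)) ^ 2)
    (fun _ _ => sq_nonneg _) (Finset.mem_univ j)

theorem enorm_gradNorm_le_sum {d : ℕ} (u : EuclideanSpace ℝ (Fin d) → ℝ)
    (x : EuclideanSpace ℝ (Fin d)) :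
    ‖gradNorm d u x‖ₑ ≤ ∑ j, ‖fderiv ℝ u x (EuclideanSpace.single j 1)‖ₑ := by
  have h : gradNorm d u x ≤ ∑ j, |fderiv ℝ u x (EuclideanSpace.single j 1)| := by
    refine Real.sqrt_le_iff.2 ⟨by positivity, ?_⟩
    calc _ = ∑ i, |fderiv ℝ u x (EuclideanSpace.single i 1)| ^ 2 := by simp
      _ ≤ _ := Finset.sum_sq_le_sq_sum_of_nonneg fun i _ => abs_nonneg _
  rw [Real.enorm_of_nonneg (gradNorm_nonneg _ _)]
  refine (ENNReal.ofReal_le_ofReal h).trans (le_of_eq ?_)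
  rw [ENNReal.ofReal_sum_of_nonneg fun _ _ => abs_nonneg _]
  simp [Real.enorm_eq_ofReal_abs]

theorem lRieszPotential_mono {E : Type*} [NormedAddCommGroup E] [MeasurableSpace E]
    [NormedSpace ℝ E] (μ : Measure E) (α : ℝ) {f g : E → ℝ≥0∞} (h : ∀ y, f y ≤ g y) (x : E) :
    lRieszPotential μ α f x ≤ lRieszPotential μ α g x :=
  lintegral_mono fun y => mul_le_mul_left (h y) _

end Euclidean

theorem theorem10p7p1 (d : ℕ) (r p : ℝ) (hr : 1 < r) (hrp : r < p) :
    (∀ α : ℝ, 0 < α → α < (d : ℝ) →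
      ∃ N : ℝ≥0, ∀ (b f : EuclideanSpace ℝ (Fin d) → ℝ) (A : ℝ≥0∞),
        AEMeasurable b volume → (∀ x, 0 ≤ b x) → MemLp f (ENNReal.ofReal r) volume →
        morreyNorm d p α b ≤ A →
        (A ≠ ⊤ → ∀ᵐ x ∂volume, b x ≠ 0 →
          Integrable (fun y => f y / ‖x - y‖ ^ ((d : ℝ) - α)) volume) ∧
        (∫⁻ x, ‖b x‖ₑ ^ r * ‖rieszPotential d α f x‖ₑ ^ r) ≤
          (N : ℝ≥0∞) * A ^ r * (∫⁻ x, ‖f x‖ₑ ^ r)) ∧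
    (2 ≤ d →
      ∃ N : ℝ≥0, ∀ (b u : EuclideanSpace ℝ (Fin d) → ℝ) (A : ℝ≥0∞),
        AEMeasurable b volume → (∀ x, 0 ≤ b x) → ContDiff ℝ ∞ u → HasCompactSupport u →
        morreyNorm d p 1 b ≤ A →
        (∫⁻ x, ‖b x‖ₑ ^ r * ‖u x‖ₑ ^ r) ≤
          (N : ℝ≥0∞) * A ^ r * (∫⁻ x, ‖gradNorm d u x‖ₑ ^ r) ∧
        (∫⁻ x, ‖b x‖ₑ ^ r * ‖gradNorm d u x‖ₑ ^ r) ≤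
          (N : ℝ≥0∞) * A ^ r * (∫⁻ x, ‖hessNorm d u x‖ₑ ^ r)) := by
  have hr0 : 0 < r := by linarith
  constructor
  · intro α hα hαd
    obtain ⟨N, hN⟩ := exists_lintegral_enorm_rpow_mul_lRieszPotential_le hr hrp hα hαd
    refine ⟨N, fun b f A hb _ hf hA => ?_⟩
    have hfm := hf.aestronglyMeasurable.aemeasurable.enorm
    have hmain := hN b (fun x => ‖f x‖ₑ) A hb hfm hA
    refine ⟨fun hAt => ?_, le_trans (lintegral_mono fun x => ?_) hmain⟩
    · have hfin : ∫⁻ x, ‖f x‖ₑ ^ r ≠ ⊤ := by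
        have := (lintegral_rpow_enorm_lt_top_of_eLpNorm_lt_top (by simpa using hr0)
          ENNReal.ofReal_ne_top hf.eLpNorm_lt_top).ne
        rwa [ENNReal.toReal_ofReal hr0.le] at this
      have hpot : lRieszPotential volume α (fun y => ‖f y‖ₑ) =
          lRieszPotential volume α (hfm.mk _) := funext fun x =>
        lintegral_congr_ae (by filter_upwards [hfm.ae_eq_mk] with y hy; rw [hy])
      have hmeas : AEMeasurable (fun x =>
          ‖b x‖ₑ ^ r * lRieszPotential volume α (fun y => ‖f y‖ₑ) x ^ r) volume := by
        rw [hpot]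
        exact (hb.enorm.pow_const r).mul
          ((measurable_lRieszPotential volume α hfm.measurable_mk).pow_const r).aemeasurable
      have hlt := ae_lt_top' hmeas (ne_top_of_le_ne_top (ENNReal.mul_ne_top (ENNReal.mul_ne_top
        ENNReal.coe_ne_top (ENNReal.rpow_ne_top_of_nonneg hr0.le hAt)) hfin) hmain)
      filter_upwards [hlt] with x hx hbx
      refine integrable_div_norm_rpow hαd hf.aestronglyMeasurable fun htop => ?_
      rw [htop, ENNReal.top_rpow_of_pos hr0, ENNReal.mul_top] at hx
      · exact lt_irrefl _ hx
      · simp [ENNReal.rpow_eq_zero_iff, hbx]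
    · gcongr
      exact enorm_rieszPotential_le hαd f x
  · intro hd
    have : NeZero d := ⟨by omega⟩
    obtain ⟨N, hN⟩ := exists_lintegral_enorm_rpow_mul_lRieszPotential_le (d := d) (α := 1) hr hrp
      one_pos (by exact_mod_cast hd)
    obtain ⟨C, hC⟩ := exists_enorm_le_lRieszPotential_fderiv
      (volume : Measure (EuclideanSpace ℝ (Fin d)))
    refine ⟨(d * C) ^ r * N, fun b u A hb _ hu hc hA => ?_⟩
    have key : ∀ v G : EuclideanSpace ℝ (Fin d) → ℝ, Continuous G →
        (∀ x, ‖v x‖ₑ ≤ (d * C : ℝ≥0) * lRieszPotential volume 1 (fun y => ‖G y‖ₑ) x) →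
        ∫⁻ x, ‖b x‖ₑ ^ r * ‖v x‖ₑ ^ r ≤
          (((d * C) ^ r * N : ℝ≥0) : ℝ≥0∞) * A ^ r * ∫⁻ x, ‖G x‖ₑ ^ r := by
      intro v G hG hv
      calc ∫⁻ x, ‖b x‖ₑ ^ r * ‖v x‖ₑ ^ r
          ≤ ∫⁻ x, ((d * C : ℝ≥0) : ℝ≥0∞) ^ r *
            (‖b x‖ₑ ^ r * lRieszPotential volume 1 (fun y => ‖G y‖ₑ) x ^ r) := by
            refine lintegral_mono fun x => ?_
            calc ‖b x‖ₑ ^ r * ‖v x‖ₑ ^ r ≤ ‖b x‖ₑ ^ r * (((d * C : ℝ≥0) : ℝ≥0∞) *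
                  lRieszPotential volume 1 (fun y => ‖G y‖ₑ) x) ^ r :=
                  mul_le_mul_right (ENNReal.rpow_le_rpow (hv x) hr0.le) _
              _ = _ := by
                  rw [ENNReal.mul_rpow_of_nonneg _ _ hr0.le]
                  ring
        _ = ((d * C : ℝ≥0) : ℝ≥0∞) ^ r *
            ∫⁻ x, ‖b x‖ₑ ^ r * lRieszPotential volume 1 (fun y => ‖G y‖ₑ) x ^ r :=
            lintegral_const_mul' _ _ (ENNReal.rpow_ne_top_of_nonneg hr0.le ENNReal.coe_ne_top)
        _ ≤ ((d * C : ℝ≥0) : ℝ≥0∞) ^ r * (N * A ^ r * ∫⁻ x, ‖G x‖ₑ ^ r) := by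
            gcongr
            exact hN b _ A hb hG.enorm.measurable.aemeasurable hA
        _ = _ := by
            rw [← ENNReal.coe_rpow_of_nonneg _ hr0.le, ENNReal.coe_mul _ N]
            ring
    refine ⟨key u _ (continuous_gradNorm hu) fun x => ?_, key _ _ (continuous_hessNorm hu)
      fun x => ?_⟩
    · refine (hC u (hu.of_le (by simp)) hc x).trans ?_
      gcongr ?_ * ?_
      · rw [ENNReal.coe_le_coe]
        exact le_mul_of_one_le_left zero_le (by exact_mod_cast (by omega : 1 ≤ d))
      · exact lRieszPotential_mono volume 1 (enorm_fderiv_le_enorm_gradNorm u) x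
    · refine (enorm_gradNorm_le_sum u x).trans ?_
      calc ∑ j, ‖fderiv ℝ u x (EuclideanSpace.single j 1)‖ₑ
          ≤ ∑ _j : Fin d, C * lRieszPotential volume 1 (fun y => ‖hessNorm d u y‖ₑ) x := by
            refine Finset.sum_le_sum fun j _ => ?_
            refine (hC _ ((contDiff_fderiv_single hu j).of_le (by simp))
              (hc.fderiv_apply ℝ _) x).trans ?_
            gcongr
            refine lRieszPotential_mono volume 1 (fun y => ?_) x
            refine (enorm_fderiv_le_enorm_gradNorm _ y).trans ?_
            rw [Real.enorm_of_nonneg (gradNorm_nonneg _ _), Real.enorm_of_nonneg (hessNorm_nonneg _ _)]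
            exact ENNReal.ofReal_le_ofReal (gradNorm_fderiv_single_le_hessNorm u j y)
        _ = _ := by
            rw [Finset.sum_const, Finset.card_univ, Fintype.card_fin, nsmul_eq_mul]
            push_cast
            ring
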